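/- Let $n\ge 2$ be an integer and $m=n-1$. Let $\lambda\in\mathbb R$ and let $k,\alpha,\beta\in\mathbb N$ (zero allowed) satisfy $\alpha+\beta=k$. Set $\Lambda=\frac{i\lambda+k}{2}$. On $\mathbb C^{2n}=\mathbb C^n\times\mathbb C^n$, with points $(z,w)$, consider the polynomial $P_0^{\alpha,\beta}(z,w,\bar z,\bar w)=w_1^{\alpha}\,\overline{z_1}^{\,\beta}$, and let $g$ be the function on $\mathbb C^{2n}\setminus\{0\}$ which coincides with $P_0^{\alpha,\beta}$ on the unit sphere and satisfies $$g(c\,x)=\Big(\frac{c}{|c|}\Big)^{-\delta}|c|^{-i\lambda-2n}\,g(x)\qquad(c\in\mathbb C\setminus\{0\},\ \delta=\beta-\alpha),$$ that is, $g(x)=\|x\|^{-i\lambda-2n}P_0^{\alpha,\beta}(x/\|x\|)$. The non-compact form of $P_0^{\alpha,\beta}$ is the function $G_{\alpha,\beta}$ on $\mathbb C\times\mathbb C^m\times\mathbb C^m$ defined by $G_{\alpha,\beta}(s,u,v)=g\big((1,u),(2s,v)\big)$. Put $a(s,u)=\sqrt{1+4|s|^2+\|u\|^2}$. Denote by $$\mathcal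 F_\xi(G)(s,u,v)=\int_{\mathbb C^m}G(s,u,\xi)\,e^{-2i\pi\,\mathrm{Re}\langle v,\xi\rangle}\,d\xi,\qquad \langle v,\xi\rangle=\sum_{j=1}^m v_j\xi_j,$$ the partial Fourier transform in the last variable ($d\xi$ is Lebesgue measure on $\mathbb C^m\simeq\mathbb R^{2m}$). For $\nu\in\mathbb C$ and $z\in\mathbb C\setminus\,]-\infty,0]$, let $I_\nu(z)=\sum_{j\ge0}\frac{1}{\Gamma(j+1)\Gamma(j+\nu+1)}\big(\frac z2\big)^{\nu+2j}$ and let $K_\nu$ be the modified Bessel function of the third kind: $K_\nu(z)=\frac{\pi}{2}\,\frac{I_{-\nu}(z)-I_\nu(z)}{\sin(\nu\pi)}$ if $\nu\notin\mathbb Z$, and $K_\nu(z)=\lim_{\epsilon\to\nu,\ \epsilon\neq\nu}K_\epsilon(z)$ if $\nu\in\mathbb Z$. Then for all $(s,u,v)\in\mathbb C\times\mathbb C^m\times\mathbb C^m$ with $v\neq0$, the function $\xi\mapsto G_{\alpha,\beta}(s,u,\xi)$ is integrable on $\mathbb C^m$ and $$\mathcal F_\xi(G_{\alpha,\beta})(s,u,v)=2^{\alpha+1}s^{\alpha}\,\frac{\pi^{\Lambda+n}}{\Gamma(\Lambda+n)}\left(\frac{\|v\|}{a(s,u)}\right)^{\Lambda+1}K_{\Lambda+1}\big(2\pi\,a(s,u)\,\|v\|\big).$$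 -/

import Mathlib

open MeasureTheory Filter Topology

noncomputable section

namespace SymplecticBessel

/-- The complex space `ℂ^m` with its Hermitian norm; its volume is Lebesgue measure on `ℝ^{2m}`. -/
abbrev CVec (m : ℕ) : Type := EuclideanSpace ℂ (Fin m)

/-- The space `ℂ^{2n} = ℂ^n × ℂ^n` with its Hermitian norm; its points are written `(z, w)`. -/
abbrev CPair (n : ℕ) : Type := WithLp 2 (CVec n × CVec n)

/-- The polynomial `P_0^{α,β}(z, w, z̄, w̄) = w_1^α * (conj z_1)^β` on `ℂ^{2n}`, where `n = m + 1`. -/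
def hwPoly (m α β : ℕ) (x : CPair (m + 1)) : ℂ :=
  (x.snd 0) ^ α * (starRingEnd ℂ (x.fst 0)) ^ β

/-- The function on `ℂ^{2n} \ {0}`, `n = m + 1`, that lies in the induced picture with parameter
`iλ` and coincides with `P_0^{α,β}` on the unit sphere:
`g(x) = (1 / ‖x‖)^{iλ + 2n} P_0^{α,β}(x / ‖x‖)`. -/
def inducedForm (m : ℕ) (lam : ℝ) (α β : ℕ) (x : CPair (m + 1)) : ℂ :=
  (((1 / ‖x‖ : ℝ)) : ℂ) ^ (Complex.I * lam + 2 * ((m + 1 : ℕ) : ℂ)) *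
    hwPoly m α β (((1 / ‖x‖ : ℝ) : ℂ) • x)

/-- `inducedForm` extends the restriction of `P_0^{α,β}` to the unit sphere. -/
theorem inducedForm_of_norm_eq_one (m : ℕ) (lam : ℝ) (α β : ℕ) (x : CPair (m + 1))
    (hx : ‖x‖ = 1) : inducedForm m lam α β x = hwPoly m α β x := by
  simp [inducedForm, hx]

/-- `inducedForm` has the covariance of the induced picture, with `δ = β - α`:
`g(c x) = (c / |c|)^{-δ} |c|^{-iλ-2n} g(x)`. -/
theorem inducedForm_smul (m : ℕ) (lam : ℝ) (α β : ℕ) (c : ℂ) (hc : c ≠ 0)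
    (x : CPair (m + 1)) :
    inducedForm m lam α β (c • x) =
      (c / (‖c‖ : ℂ)) ^ (-((β : ℤ) - (α : ℤ))) *
        (‖c‖ : ℂ) ^ (-(Complex.I * lam) - 2 * ((m + 1 : ℕ) : ℂ)) * inducedForm m lam α β x := by
  rcases eq_or_ne x 0 with rfl | hx
  · have h0 : Complex.I * (lam : ℂ) + 2 * ((m + 1 : ℕ) : ℂ) ≠ 0 := by
      intro h
      have h1 := congrArg Complex.re h
      simp at h1
      norm_cast at h1
    simp only [inducedForm, smul_zero, norm_zero, div_zero, Complex.ofReal_zero,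
      Complex.zero_cpow h0, zero_mul, mul_zero]
  have hc' : 0 < ‖c‖ := norm_pos_iff.mpr hc
  have hx' : 0 < ‖x‖ := norm_pos_iff.mpr hx
  have hcC : (‖c‖ : ℂ) ≠ 0 := by exact_mod_cast hc'.ne'
  have hxC : (‖x‖ : ℂ) ≠ 0 := by exact_mod_cast hx'.ne'
  have hnorm : (1 / ‖c • x‖ : ℝ) = ‖c‖⁻¹ * (1 / ‖x‖) := by
    rw [norm_smul]; field_simp
  set w : ℂ := c / (‖c‖ : ℂ) with hw
  have hw0 : w ≠ 0 := div_ne_zero hc hcC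
  have hww : starRingEnd ℂ w = w⁻¹ := by
    rw [Complex.inv_def]
    have : Complex.normSq w = 1 := by
      rw [Complex.normSq_eq_norm_sq, hw, norm_div, Complex.norm_real, norm_norm,
        div_self hc'.ne', one_pow]
    simp [this]
  have hvec : (((1 / ‖c • x‖ : ℝ) : ℂ) • (c • x)) = w • (((1 / ‖x‖ : ℝ) : ℂ) • x) := by
    rw [hnorm, smul_smul, smul_smul]
    congr 1
    rw [hw]
    push_cast
    field_simp
  have hpoly : ∀ y : CPair (m + 1), hwPoly m α β (w • y) =
      w ^ (-((β : ℤ) - (α : ℤ))) * hwPoly m α β y := by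
    intro y
    have hz : w ^ (-((β : ℤ) - (α : ℤ))) = w ^ α * (w⁻¹) ^ β := by
      rw [show -((β : ℤ) - (α : ℤ)) = (α : ℤ) - (β : ℤ) by ring, zpow_sub₀ hw0]
      simp [div_eq_mul_inv]
    simp only [hwPoly, WithLp.smul_fst, WithLp.smul_snd, PiLp.smul_apply, smul_eq_mul, map_mul,
      hww, hz]
    ring
  have hpow : (((1 / ‖c • x‖ : ℝ)) : ℂ) ^ (Complex.I * lam + 2 * ((m + 1 : ℕ) : ℂ)) =
      (‖c‖ : ℂ) ^ (-(Complex.I * lam) - 2 * ((m + 1 : ℕ) : ℂ)) *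
        (((1 / ‖x‖ : ℝ)) : ℂ) ^ (Complex.I * lam + 2 * ((m + 1 : ℕ) : ℂ)) := by
    rw [hnorm, Complex.ofReal_mul, Complex.mul_cpow_ofReal_nonneg (by positivity) (by positivity)]
    congr 1
    rw [show -(Complex.I * (lam : ℂ)) - 2 * ((m + 1 : ℕ) : ℂ) =
      -(Complex.I * lam + 2 * ((m + 1 : ℕ) : ℂ)) by ring, Complex.cpow_neg, Complex.ofReal_inv,
      Complex.inv_cpow]
    rw [Complex.arg_ofReal_of_nonneg hc'.le]
    exact Real.pi_pos.ne
  rw [inducedForm, hvec, hpoly, hpow, inducedForm]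
  ring

/-- The point `(1, u, 2s, v)` of `ℂ^{2n} = ℂ × ℂ^m × ℂ × ℂ^m`, where `n = m + 1`. -/
def hyperplanePoint {m : ℕ} (s : ℂ) (u v : CVec m) : CPair (m + 1) :=
  WithLp.toLp 2
    (WithLp.toLp 2 (Fin.cons (1 : ℂ) (fun i => u i) : Fin (m + 1) → ℂ),
     WithLp.toLp 2 (Fin.cons (2 * s) (fun i => v i) : Fin (m + 1) → ℂ))

/-- The non-compact form `G_{α,β}(s, u, v) = g(1, u, 2s, v)` of `P_0^{α,β}`. -/
def nonCompactForm (m : ℕ) (lam : ℝ) (α β : ℕ) (s : ℂ) (u v : CVec m) : ℂ :=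
  inducedForm m lam α β (hyperplanePoint s u v)

/-- The partial Fourier transform in the last variable:
`F_ξ(g)(s, u, v) = ∫_{ℂ^m} g(s, u, ξ) exp(-2iπ Re ⟨v, ξ⟩) dξ`, where `⟨v, ξ⟩ = ∑ v_i ξ_i`
is complex bilinear. -/
def fourierXi {m : ℕ} (g : ℂ → CVec m → CVec m → ℂ) (s : ℂ) (u v : CVec m) : ℂ :=
  ∫ ξ : CVec m, g s u ξ *
    Complex.exp (-2 * Complex.I * (Real.pi : ℂ) * ((∑ i, v i * ξ i).re : ℂ))

/-- `a(s, u) = √(1 + 4|s|² + ‖u‖²)`. -/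
def aFun {m : ℕ} (s : ℂ) (u : CVec m) : ℝ :=
  Real.sqrt (1 + 4 * ‖s‖ ^ 2 + ‖u‖ ^ 2)

/-- The modified Bessel function of the first kind
`I_ν(z) = ∑_k (z/2)^{ν+2k} / (Γ(k+1) Γ(k+ν+1))`, for `z ≠ 0` with `-π < arg z < π`.
At a pole of `Γ` the reciprocal is read as `0`, which is also the value of `Gamma⁻¹` here. -/
def besselI (ν z : ℂ) : ℂ :=
  ∑' k : ℕ, (Complex.Gamma ((k : ℂ) + 1) * Complex.Gamma ((k : ℂ) + ν + 1))⁻¹ *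
    (z / 2) ^ (ν + 2 * (k : ℂ))

/-- The quotient `(π/2) (I_{-ν}(z) - I_ν(z)) / sin(νπ)`, meaningful for `ν` not an integer. -/
def besselKAux (ν z : ℂ) : ℂ :=
  (Real.pi : ℂ) / 2 * ((besselI (-ν) z - besselI ν z) / Complex.sin (ν * (Real.pi : ℂ)))

open Classical in
/-- The modified Bessel function of the third kind `K_ν(z)`, for `z ≠ 0` with `-π < arg z < π`:
the quotient above if `ν` is not an integer, and its limit as `ε → ν`, `ε ≠ ν`, if `ν` is an
integer. -/
def besselK (ν z : ℂ) : ℂ :=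
  if ∃ j : ℤ, ν = (j : ℂ) then limUnder (𝓝[≠] ν) (fun ε : ℂ => besselKAux ε z)
  else besselKAux ν z

end SymplecticBessel

end

/-!
Since `‖(1, u, 2s, ξ)‖² = a² + ‖ξ‖²` with `a = a(s, u)`, the function to be transformed is
`(2s)^α (a² + ‖ξ‖²)^{-μ}` with `μ = Λ + n` (`nonCompactForm_eq`). Write the power as the Gamma
integral `Γ(μ)⁻¹ ∫_0^∞ t^{μ-1} e^{-t(a² + ‖ξ‖²)} dt`. The double integral converges absolutely because
`2 Re μ > 2m`, so Fubini's theorem and the Fourier transform of a Gaussian turn the left-hand side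
into a multiple of `∫_0^∞ t^{ν-1} e^{-a² t - π²‖v‖²/t} dt` with `ν = μ - m = Λ + 1`
(`integral_one_div_add_sq_cpow_mul_exp`). Rescaling `t` makes this the Mellin transform at `ν` of
`e^{-c(t + 1/t)}`, where `c = π a ‖v‖`.

It remains to see that this Mellin transform is `2 K_ν(2c)` for the function `K_ν` defined through the
series of `I_ν` (`besselK_eq_mellin`). For `ν ∉ ℤ`, split the integral at `t = 1`; the substitution
`t ↦ 1/t` shows that it is `B(ν) + B(-ν)`, with `B` the integral over `t > 1`. Expanding
`e^{-c/t}` gives `B(ν) = ∑_k (-c)^k/k! U(ν - k)` for the incomplete Gamma integral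
`U(s) = ∫_1^∞ t^{s-1} e^{-ct} dt = Γ(s) c^{-s} - ∑_j (-c)^j / (j! (s + j))` (`upperGamma_eq`).
By the reflection formula the Gamma terms sum to `π / sin(νπ) · I_{-ν}(2c)`. The remaining double
series `∑_{k,j} (-c)^{k+j} / (k! j! (ν - k + j))` is absolutely convergent and changes sign when
`ν` is replaced by `-ν` and `k`, `j` are exchanged, so it drops out of `B(ν) + B(-ν)`. For `ν ∈ ℤ`
the identity follows from the continuity of the Mellin transform in `ν`.
-/

open MeasureTheory Filter Topology

namespace SymplecticBessel

/-! ### Incomplete Gamma integrals -/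

theorem integrableOn_Ioi_one_cpow_mul_exp {c : ℝ} (hc : 0 < c) (s : ℂ) :
    IntegrableOn (fun t : ℝ => (t : ℂ) ^ (s - 1) * Complex.exp (-(c * t))) (Set.Ioi 1) := by
  have hdom : IntegrableOn (fun t : ℝ => t ^ |s.re - 1| * Real.exp (-c * t)) (Set.Ioi 1) := by
    have := integrableOn_rpow_mul_exp_neg_mul_rpow (p := 1) (s := |s.re - 1|) (b := c)
      (by linarith [abs_nonneg (s.re - 1)]) one_pos hc
    simp only [Real.rpow_one] at this
    exact this.mono_set (Set.Ioi_subset_Ioi zero_le_one)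
  refine hdom.mono' ?_ ?_
  · refine ContinuousOn.aestronglyMeasurable ?_ measurableSet_Ioi
    intro t ht
    have ht0 : (0 : ℝ) < t := zero_lt_one.trans ht
    refine ContinuousAt.continuousWithinAt ?_
    refine ContinuousAt.mul ?_ (by fun_prop)
    exact Complex.continuousAt_ofReal_cpow_const _ _ (Or.inr ht0.ne')
  · refine (ae_restrict_mem measurableSet_Ioi).mono fun t ht => ?_
    have ht1 : (1 : ℝ) < t := ht
    have ht0 : (0 : ℝ) < t := zero_lt_one.trans ht1
    rw [norm_mul, Complex.norm_cpow_eq_rpow_re_of_pos ht0, Complex.norm_exp]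
    have hre : (-((c : ℂ) * t)).re = -c * t := by simp
    rw [hre]
    gcongr
    · exact ht1.le
    · simpa using le_abs_self (s.re - 1)

/-- The incomplete Gamma integral `∫_1^∞ t^{s-1} e^{-ct} dt`, absolutely convergent for every `s`
as `c > 0`. The limit `1` of integration is fixed, and `c` is the parameter. -/
noncomputable def upperGamma (c : ℝ) (s : ℂ) : ℂ :=
  ∫ t : ℝ in Set.Ioi 1, (t : ℂ) ^ (s - 1) * Complex.exp (-(c * t))

/-- The terms of the exponential series at `-c`. -/
noncomputable def expTerm (c : ℝ) (j : ℕ) : ℂ := (-(c : ℂ)) ^ j / (j.factorial : ℂ)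

theorem summable_norm_expTerm (c : ℝ) : Summable fun j => ‖expTerm c j‖ :=
  NormedSpace.norm_expSeries_div_summable (-(c : ℂ))

theorem hasSum_expTerm (c : ℝ) : HasSum (expTerm c) (Complex.exp (-c)) := by
  rw [Complex.exp_eq_exp_ℂ]
  exact NormedSpace.expSeries_div_hasSum_exp (-(c : ℂ))

theorem expTerm_mul_pow (c t : ℝ) (j : ℕ) : expTerm (c * t) j = expTerm c j * (t : ℂ) ^ j := by
  simp only [expTerm, Complex.ofReal_mul, ← neg_mul, mul_pow]
  ring

theorem expTerm_succ_mul (c : ℝ) (j : ℕ) :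
    expTerm c (j + 1) * ((j : ℂ) + 1) = -(c : ℂ) * expTerm c j := by
  have h : ((j : ℂ) + 1) ≠ 0 := by exact_mod_cast j.succ_ne_zero
  have h' : (j.factorial : ℂ) ≠ 0 := by exact_mod_cast j.factorial_ne_zero
  simp only [expTerm, Nat.factorial_succ]
  push_cast
  field_simp
  ring

theorem integrableOn_Ioc_cpow {s : ℂ} (hs : 0 < s.re) :
    IntegrableOn (fun t : ℝ => (t : ℂ) ^ (s - 1)) (Set.Ioc 0 1) := by
  rw [← intervalIntegrable_iff_integrableOn_Ioc_of_le zero_le_one]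
  exact intervalIntegral.intervalIntegrable_cpow' (by simp [hs])

theorem integral_Ioc_cpow {s : ℂ} (hs : 0 < s.re) :
    ∫ t : ℝ in Set.Ioc 0 1, (t : ℂ) ^ (s - 1) = 1 / s := by
  have h0 : s ≠ 0 := fun h => by simp [h] at hs
  rw [← intervalIntegral.integral_of_le zero_le_one,
    integral_cpow (Or.inl (by simp [hs]))]
  simp [Complex.zero_cpow h0]

/-- Termwise integration of the exponential series over `(0, 1]`. -/
theorem hasSum_lowerGamma {c : ℝ} {s : ℂ} (hs : 0 < s.re) :
    HasSum (fun j : ℕ => expTerm c j / (s + j))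
      (∫ t : ℝ in Set.Ioc 0 1, (t : ℂ) ^ (s - 1) * Complex.exp (-(c * t))) := by
  have hterm : ∀ (j : ℕ) {t : ℝ}, t ∈ Set.Ioc (0 : ℝ) 1 →
      (t : ℂ) ^ (s - 1) * expTerm (c * t) j = expTerm c j * (t : ℂ) ^ (s + j - 1) := by
    intro j t ht
    have : (t : ℂ) ≠ 0 := by exact_mod_cast ht.1.ne'
    rw [expTerm_mul_pow, show s + j - 1 = (s - 1) + j by ring, Complex.cpow_add _ _ this,
      Complex.cpow_natCast]
    ring
  have hre : ∀ j : ℕ, 0 < (s + j).re := fun j => by simpa using by positivity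
  have hF : ∀ j : ℕ, IntegrableOn (fun t : ℝ => (t : ℂ) ^ (s - 1) * expTerm (c * t) j)
      (Set.Ioc 0 1) := fun j =>
    (integrableOn_congr_fun (fun t ht => hterm j ht) measurableSet_Ioc).2
      ((integrableOn_Ioc_cpow (hre j)).const_mul _)
  have hsum : Summable fun j : ℕ =>
      ∫ t : ℝ in Set.Ioc 0 1, ‖(t : ℂ) ^ (s - 1) * expTerm (c * t) j‖ := by
    refine Summable.of_nonneg_of_le (fun j => by positivity) (fun j => ?_)
      ((summable_norm_expTerm c).mul_right
        (∫ t : ℝ in Set.Ioc 0 1, ‖(t : ℂ) ^ (s - 1)‖))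
    rw [← integral_const_mul]
    refine setIntegral_mono_on (hF j).norm ((integrableOn_Ioc_cpow hs).norm.const_mul _)
      measurableSet_Ioc fun t ht => ?_
    rw [expTerm_mul_pow, norm_mul, norm_mul, norm_pow, Complex.norm_real, Real.norm_eq_abs,
      abs_of_pos ht.1]
    have : t ^ j ≤ 1 := pow_le_one₀ ht.1.le ht.2
    calc _ = ‖expTerm c j‖ * ‖(t : ℂ) ^ (s - 1)‖ * t ^ j := by ring
      _ ≤ ‖expTerm c j‖ * ‖(t : ℂ) ^ (s - 1)‖ * 1 := by gcongr
      _ = _ := by ring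
  convert! hasSum_integral_of_summable_integral_norm hF hsum using 1
  · funext j
    rw [setIntegral_congr_fun measurableSet_Ioc (fun t ht => hterm j ht), integral_const_mul,
      integral_Ioc_cpow (hre j)]
    ring
  · refine setIntegral_congr_fun measurableSet_Ioc fun t _ => ?_
    rw [tsum_mul_left, (hasSum_expTerm _).tsum_eq]
    push_cast
    rfl

theorem upperGamma_eq_of_re_pos {c : ℝ} (hc : 0 < c) {s : ℂ} (hs : 0 < s.re) :
    upperGamma c s =
      (1 / (c : ℂ)) ^ s * Complex.Gamma s - ∑' j : ℕ, expTerm c j / (s + j) := by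
  rw [(hasSum_lowerGamma hs).tsum_eq, ← Complex.integral_cpow_mul_exp_neg_mul_Ioi hs hc,
    eq_sub_iff_add_eq', upperGamma, ← Set.Ioc_union_Ioi_eq_Ioi (zero_le_one' ℝ)]
  refine (setIntegral_union Set.Ioc_disjoint_Ioi_same measurableSet_Ioi ?_
    (integrableOn_Ioi_one_cpow_mul_exp hc s)).symm
  refine (integrableOn_Ioc_cpow hs).mul_continuousOn_of_subset (K := Set.Icc 0 1)
    (by fun_prop) measurableSet_Ioc isCompact_Icc Set.Ioc_subset_Icc_self

/-- The functional equation of the incomplete Gamma integral, by integration by parts. -/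
theorem mul_upperGamma {c : ℝ} (hc : 0 < c) (s : ℂ) :
    s * upperGamma c s = c * upperGamma c (s + 1) - Complex.exp (-c) := by
  have hder : ∀ t ∈ Set.Ioi (1 : ℝ), HasDerivAt
      (fun t : ℝ => (t : ℂ) ^ s * Complex.exp (-(c * t)))
      (s * ((t : ℂ) ^ (s - 1) * Complex.exp (-(c * t))) -
        c * ((t : ℂ) ^ (s + 1 - 1) * Complex.exp (-(c * t)))) t := by
    intro t ht
    have ht0 : (0 : ℝ) < t := zero_lt_one.trans ht
    have h1 : HasDerivAt (fun z : ℂ => z ^ s * Complex.exp (-(c * z)))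
        (s * (t : ℂ) ^ (s - 1) * 1 * Complex.exp (-(c * t)) +
          (t : ℂ) ^ s * (Complex.exp (-(c * t)) * (-(c * 1)))) (t : ℂ) := by
      refine HasDerivAt.mul ?_ ?_
      · exact (hasDerivAt_id _).cpow_const (Or.inl (by simpa using ht0))
      · exact ((hasDerivAt_id (t : ℂ)).const_mul (c : ℂ)).neg.cexp
    convert! h1.comp_ofReal using 1
    rw [add_sub_cancel_right]
    ring
  have hint := ((integrableOn_Ioi_one_cpow_mul_exp hc s).const_mul s).sub
    ((integrableOn_Ioi_one_cpow_mul_exp hc (s + 1)).const_mul (c : ℂ))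
  have hlim : Tendsto (fun t : ℝ => (t : ℂ) ^ s * Complex.exp (-(c * t))) atTop (𝓝 0) := by
    rw [tendsto_zero_iff_norm_tendsto_zero]
    refine (tendsto_rpow_mul_exp_neg_mul_atTop_nhds_zero s.re c hc).congr' ?_
    filter_upwards [eventually_gt_atTop 0] with t ht
    rw [norm_mul, Complex.norm_cpow_eq_rpow_re_of_pos ht, Complex.norm_exp]
    simp
  have hcont : ContinuousWithinAt (fun t : ℝ => (t : ℂ) ^ s * Complex.exp (-(c * t)))
      (Set.Ici 1) 1 := by
    refine ContinuousAt.continuousWithinAt (ContinuousAt.mul ?_ (by fun_prop))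
    exact Complex.continuousAt_ofReal_cpow_const _ _ (Or.inr one_ne_zero)
  have key := integral_Ioi_of_hasDerivAt_of_tendsto hcont hder hint hlim
  rw [integral_sub ((integrableOn_Ioi_one_cpow_mul_exp hc s).const_mul s)
    ((integrableOn_Ioi_one_cpow_mul_exp hc (s + 1)).const_mul (c : ℂ)),
    integral_const_mul, integral_const_mul] at key
  simp only [Complex.ofReal_one, Complex.one_cpow, mul_one, one_mul, zero_sub] at key
  simp only [upperGamma]
  linear_combination key

theorem summable_expTerm_div {c : ℝ} {s : ℂ} {δ : ℝ} (hδ : 0 < δ) (h : ∀ j : ℕ, δ ≤ ‖s + j‖) :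
    Summable fun j : ℕ => expTerm c j / (s + j) := by
  refine Summable.of_norm_bounded ((summable_norm_expTerm c).mul_right δ⁻¹) fun j => ?_
  rw [norm_div, div_eq_mul_inv]
  gcongr
  exact h j

/-- The distance of a non-integer to the integers is positive. -/
theorem exists_pos_le_norm_add_int {s : ℂ} (hs : ¬∃ j : ℤ, s = j) :
    ∃ δ : ℝ, 0 < δ ∧ ∀ j : ℤ, δ ≤ ‖s + j‖ := by
  have hmem : s ∉ Set.range ((↑) : ℤ → ℂ) := fun ⟨j, hj⟩ => hs ⟨j, hj.symm⟩
  refine ⟨Metric.infDist s (Set.range ((↑) : ℤ → ℂ)),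
    (Complex.isClosed_range_intCast.notMem_iff_infDist_pos (Set.range_nonempty _)).1 hmem,
    fun j => ?_⟩
  have := Metric.infDist_le_dist_of_mem (x := s) (Set.mem_range_self (f := ((↑) : ℤ → ℂ)) (-j))
  simpa [dist_eq_norm] using this

theorem not_int_add_int {s : ℂ} (hs : ¬∃ j : ℤ, s = j) (i : ℤ) : ¬∃ j : ℤ, s + i = j := by
  rintro ⟨j, hj⟩
  exact hs ⟨j - i, by push_cast; rw [← hj]; ring⟩

/-- The series of the lower incomplete Gamma integral satisfies the functional equation on all of
`ℂ \ ℤ`, also where the integral diverges. -/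
theorem tsum_expTerm_div_succ {c : ℝ} {s : ℂ} (hs : ¬∃ j : ℤ, s = j) :
    s * ∑' j : ℕ, expTerm c j / (s + j) =
      Complex.exp (-c) + c * ∑' j : ℕ, expTerm c j / (s + 1 + j) := by
  obtain ⟨δ, hδ, h⟩ := exists_pos_le_norm_add_int hs
  have hne : ∀ j : ℤ, s + j ≠ 0 := fun j hj => by
    have := h j
    rw [hj, norm_zero] at this
    linarith
  have hsum : Summable fun j : ℕ => expTerm c j / (s + j) :=
    summable_expTerm_div hδ fun j => by simpa using h j
  have hsum' : Summable fun j : ℕ => expTerm c j / (s + 1 + j) :=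
    summable_expTerm_div hδ fun j => by
      have := h (j + 1)
      push_cast at this
      rwa [add_assoc, add_comm (1 : ℂ)]
  have hshift : HasSum (fun j : ℕ => j * (expTerm c j / (s + j)))
      (-(c : ℂ) * ∑' j : ℕ, expTerm c j / (s + 1 + j)) := by
    rw [← hasSum_nat_add_iff' 1]
    simp only [Finset.range_one, Finset.sum_singleton, Nat.cast_zero, zero_mul, sub_zero]
    convert! hsum'.hasSum.mul_left (-(c : ℂ)) using 1
    funext j
    have h1 := expTerm_succ_mul c j
    push_cast
    rw [mul_div_assoc', mul_comm, h1, mul_div_assoc', show s + ((j : ℂ) + 1) = s + 1 + j by ring]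
  have h2 := (hsum.hasSum.mul_left s).add hshift
  have h3 : (fun j : ℕ => s * (expTerm c j / (s + j)) + j * (expTerm c j / (s + j))) =
      expTerm c := by
    funext j
    have := hne j
    push_cast at this
    field_simp
  rw [h3] at h2
  linear_combination h2.unique (hasSum_expTerm c)

/-- The functional equation carries `upperGamma_eq_of_re_pos` to the left, one strip at a time. -/
theorem upperGamma_eq {c : ℝ} (hc : 0 < c) {s : ℂ} (hs : ¬∃ j : ℤ, s = j) :
    upperGamma c s =
      (1 / (c : ℂ)) ^ s * Complex.Gamma s - ∑' j : ℕ, expTerm c j / (s + j) := by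
  have key : ∀ (N : ℕ) (s : ℂ), (¬∃ j : ℤ, s = j) → 0 < s.re + N → upperGamma c s =
      (1 / (c : ℂ)) ^ s * Complex.Gamma s - ∑' j : ℕ, expTerm c j / (s + j) := by
    intro N
    induction N with
    | zero => exact fun s _ h => upperGamma_eq_of_re_pos hc (by simpa using h)
    | succ N ih =>
      intro s hs h
      have hs0 : s ≠ 0 := fun h0 => hs ⟨0, by simpa using h0⟩
      have hc0 : (1 / (c : ℂ)) ≠ 0 := by simpa using hc.ne'
      have hc1 : (c : ℂ) ≠ 0 := by simpa using hc.ne'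
      have h1 := ih (s + 1) (by simpa using not_int_add_int hs 1) (by
        push_cast at h
        simp only [Complex.add_re, Complex.one_re]
        linarith)
      rw [Complex.Gamma_add_one s hs0, Complex.cpow_add _ _ hc0, Complex.cpow_one] at h1
      have h2 := mul_upperGamma hc s
      have h3 := tsum_expTerm_div_succ (c := c) hs
      refine mul_left_cancel₀ hs0 ?_
      have hcc : (c : ℂ) * (1 / c) = 1 := mul_one_div_cancel hc1
      rw [h2, h1]
      linear_combination (1 / (c : ℂ)) ^ s * s * Complex.Gamma s * hcc + h3
  obtain ⟨N, hN⟩ := exists_nat_gt (-s.re)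
  exact key N s hs (by linarith)

/-! ### The Mellin integral of the Bessel function `K_ν` -/

/-- The kernel `exp(-c (t + 1/t))`, whose Mellin transform at `ν` is `2 K_ν(2c)`. -/
noncomputable def besselKernel (c t : ℝ) : ℂ := Complex.exp (-(c * (t + (t : ℂ)⁻¹)))

theorem norm_besselKernel_le {c t : ℝ} (hc : 0 < c) (ht : 0 < t) :
    ‖besselKernel c t‖ ≤ ‖Complex.exp (-(c * t))‖ := by
  have h : 0 < c * t⁻¹ := by positivity
  rw [besselKernel, Complex.norm_exp, Complex.norm_exp, Real.exp_le_exp, ← Complex.ofReal_inv]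
  norm_cast
  linarith

theorem besselKernel_inv (c t : ℝ) : besselKernel c t⁻¹ = besselKernel c t := by
  simp [besselKernel, add_comm]

theorem continuousAt_besselKernel (c : ℝ) {t : ℝ} (ht : 0 < t) :
    ContinuousAt (besselKernel c) t := by
  have : (t : ℂ) ≠ 0 := by exact_mod_cast ht.ne'
  unfold besselKernel
  fun_prop (disch := assumption)

theorem integrableOn_Ioi_one_besselKernel {c : ℝ} (hc : 0 < c) (ν : ℂ) :
    IntegrableOn (fun t : ℝ => (t : ℂ) ^ (ν - 1) * besselKernel c t) (Set.Ioi 1) := by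
  refine Integrable.mono (integrableOn_Ioi_one_cpow_mul_exp hc ν) ?_ ?_
  · refine ContinuousOn.aestronglyMeasurable (fun t ht => ?_) measurableSet_Ioi
    have ht0 : (0 : ℝ) < t := zero_lt_one.trans ht
    exact (ContinuousAt.mul (Complex.continuousAt_ofReal_cpow_const _ _ (Or.inr ht0.ne'))
      (continuousAt_besselKernel c ht0)).continuousWithinAt
  · refine (ae_restrict_mem measurableSet_Ioi).mono fun t ht => ?_
    rw [norm_mul, norm_mul]
    gcongr
    exact norm_besselKernel_le hc (zero_lt_one.trans ht)

/-- Expanding `e^{-c/t}` on `t > 1` writes half of the Mellin transform of `besselKernel` as a series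
of incomplete Gamma integrals. -/
theorem hasSum_upperGamma {c : ℝ} (hc : 0 < c) (ν : ℂ) :
    HasSum (fun k : ℕ => expTerm c k * upperGamma c (ν - k))
      (∫ t : ℝ in Set.Ioi 1, (t : ℂ) ^ (ν - 1) * besselKernel c t) := by
  have hterm : ∀ (k : ℕ) {t : ℝ}, t ∈ Set.Ioi (1 : ℝ) →
      (t : ℂ) ^ (ν - 1) * Complex.exp (-(c * t)) * expTerm (c * t⁻¹) k =
        expTerm c k * ((t : ℂ) ^ (ν - k - 1) * Complex.exp (-(c * t))) := by
    intro k t ht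
    have ht0 : (0 : ℝ) < t := zero_lt_one.trans ht
    have h0 : (t : ℂ) ≠ 0 := by exact_mod_cast ht0.ne'
    rw [expTerm_mul_pow, show ν - k - 1 = (ν - 1) - k by ring, Complex.cpow_sub (ν - 1) k h0,
      Complex.cpow_natCast, Complex.ofReal_inv, inv_pow]
    ring
  have hF : ∀ k : ℕ, IntegrableOn (fun t : ℝ =>
      (t : ℂ) ^ (ν - 1) * Complex.exp (-(c * t)) * expTerm (c * t⁻¹) k) (Set.Ioi 1) := fun k =>
    (integrableOn_congr_fun (fun t ht => hterm k ht) measurableSet_Ioi).2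
      ((integrableOn_Ioi_one_cpow_mul_exp hc _).const_mul _)
  have hsum : Summable fun k : ℕ => ∫ t : ℝ in Set.Ioi 1,
      ‖(t : ℂ) ^ (ν - 1) * Complex.exp (-(c * t)) * expTerm (c * t⁻¹) k‖ := by
    refine Summable.of_nonneg_of_le (fun j => by positivity) (fun k => ?_)
      ((summable_norm_expTerm c).mul_right
        (∫ t : ℝ in Set.Ioi 1, ‖(t : ℂ) ^ (ν - 1) * Complex.exp (-(c * t))‖))
    rw [← integral_const_mul]
    refine setIntegral_mono_on (hF k).norm
      ((integrableOn_Ioi_one_cpow_mul_exp hc ν).norm.const_mul _)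
      measurableSet_Ioi fun t ht => ?_
    have ht1 : (1 : ℝ) < t := ht
    have ht0 : (0 : ℝ) < t := zero_lt_one.trans ht1
    rw [expTerm_mul_pow, norm_mul _ (_ * _), norm_mul (expTerm c k), norm_pow, Complex.norm_real,
      Real.norm_eq_abs, abs_of_pos (inv_pos.2 ht0)]
    have : t⁻¹ ^ k ≤ 1 := pow_le_one₀ (inv_pos.2 ht0).le (inv_le_one_of_one_le₀ ht1.le)
    set A := ‖(t : ℂ) ^ (ν - 1) * Complex.exp (-(c * t))‖
    calc _ = ‖expTerm c k‖ * A * t⁻¹ ^ k := by ring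
      _ ≤ ‖expTerm c k‖ * A * 1 := by gcongr
      _ = _ := by ring
  convert! hasSum_integral_of_summable_integral_norm hF hsum using 1
  · funext k
    rw [setIntegral_congr_fun measurableSet_Ioi (fun t ht => hterm k ht), integral_const_mul,
      upperGamma]
  · refine setIntegral_congr_fun measurableSet_Ioi fun t _ => ?_
    rw [tsum_mul_left, (hasSum_expTerm _).tsum_eq, mul_assoc, ← Complex.exp_add, besselKernel]
    push_cast
    ring_nf

theorem summable_expTerm_mul_expTerm_div {c : ℝ} {ν : ℂ} (hν : ¬∃ j : ℤ, ν = j) :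
    Summable fun p : ℕ × ℕ => expTerm c p.1 * (expTerm c p.2 / (ν - p.1 + p.2)) := by
  obtain ⟨δ, hδ, h⟩ := exists_pos_le_norm_add_int hν
  refine Summable.of_norm_bounded
    (((summable_norm_expTerm c).mul_of_nonneg (summable_norm_expTerm c)
      (fun _ => norm_nonneg _) (fun _ => norm_nonneg _)).mul_right δ⁻¹) fun p => ?_
  have h1 := h (p.2 - p.1)
  rw [norm_mul, norm_div, div_eq_mul_inv, ← mul_assoc]
  gcongr
  push_cast at h1
  rwa [show ν - p.1 + p.2 = ν + (p.2 - p.1 : ℂ) by ring]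

/-- The two double series left over by the incomplete Gamma functions cancel, by exchanging the
summation indices. -/
theorem tsum_tsum_expTerm_div_neg {c : ℝ} {ν : ℂ} (hν : ¬∃ j : ℤ, ν = j) :
    ∑' k : ℕ, ∑' j : ℕ, expTerm c k * (expTerm c j / (-ν - k + j)) =
      -∑' k : ℕ, ∑' j : ℕ, expTerm c k * (expTerm c j / (ν - k + j)) := by
  rw [← Summable.tsum_comm (f := fun k j : ℕ => expTerm c k * (expTerm c j / (ν - k + j)))
    (summable_expTerm_mul_expTerm_div hν), ← tsum_neg]
  refine tsum_congr fun k => ?_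
  rw [← tsum_neg]
  refine tsum_congr fun j => ?_
  rw [show -ν - (k : ℂ) + j = -(ν - j + k) by ring, div_neg]
  ring

theorem sin_mul_pi_ne_zero {ν : ℂ} (hν : ¬∃ j : ℤ, ν = j) : Complex.sin (ν * Real.pi) ≠ 0 := by
  rw [Complex.sin_ne_zero_iff]
  intro k hk
  have hpi : (Real.pi : ℂ) ≠ 0 := by exact_mod_cast Real.pi_ne_zero
  exact hν ⟨k, mul_right_cancel₀ hpi hk⟩

/-- By the reflection formula, the terms `(-c)^k/k! Γ(ν-k) c^{k-ν}` are those of the series of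
`I_{-ν}(2c)`, up to the factor `π / sin(νπ)`. -/
theorem expTerm_mul_Gamma {c : ℝ} (hc : 0 < c) {ν : ℂ} (hν : ¬∃ j : ℤ, ν = j) (k : ℕ) :
    expTerm c k * ((1 / (c : ℂ)) ^ (ν - k) * Complex.Gamma (ν - k)) =
      Real.pi / Complex.sin (ν * Real.pi) *
        ((Complex.Gamma ((k : ℂ) + 1) * Complex.Gamma ((k : ℂ) + -ν + 1))⁻¹ *
          (((2 * c : ℝ) : ℂ) / 2) ^ (-ν + 2 * (k : ℂ))) := by
  have hc0 : (c : ℂ) ≠ 0 := by exact_mod_cast hc.ne'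
  have harg : (c : ℂ).arg ≠ Real.pi := by
    rw [Complex.arg_ofReal_of_nonneg hc.le]
    exact Real.pi_pos.ne
  have hs := sin_mul_pi_ne_zero hν
  have hG : Complex.Gamma ((k : ℂ) + -ν + 1) ≠ 0 := by
    refine Complex.Gamma_ne_zero fun m hm => hν ⟨k + 1 + m, ?_⟩
    push_cast
    linear_combination -hm
  have hfac : (k.factorial : ℂ) ≠ 0 := by exact_mod_cast k.factorial_ne_zero
  have hrefl := Complex.Gamma_mul_Gamma_one_sub (ν - k)
  have hsin : Complex.sin (Real.pi * (ν - k)) = (-1) ^ k * Complex.sin (ν * Real.pi) := by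
    rw [mul_sub, mul_comm (Real.pi : ℂ) k, mul_comm (Real.pi : ℂ) ν,
      Complex.sin_antiperiodic.sub_nat_mul_eq]
  have hpow : (c : ℂ) ^ k * (1 / (c : ℂ)) ^ (ν - k) = (c : ℂ) ^ (-ν + 2 * (k : ℂ)) := by
    rw [one_div, Complex.inv_cpow _ _ harg, ← Complex.cpow_neg, ← Complex.cpow_natCast,
      ← Complex.cpow_add _ _ hc0]
    congr 1
    ring
  rw [hsin, show 1 - (ν - k) = (k : ℂ) + -ν + 1 by ring] at hrefl
  have hΓ : Complex.Gamma (ν - k) =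
      Real.pi / ((-1) ^ k * Complex.sin (ν * Real.pi)) / Complex.Gamma ((k : ℂ) + -ν + 1) :=
    eq_div_of_mul_eq hG hrefl
  have h2c : ((2 * c : ℝ) : ℂ) / 2 = c := by push_cast; ring
  rw [h2c, ← hpow, hΓ, Complex.Gamma_nat_eq_factorial, expTerm, neg_pow]
  have hone : ((-1 : ℂ)) ^ k ≠ 0 := pow_ne_zero _ (by norm_num)
  generalize (1 / (c : ℂ)) ^ (ν - k) = X
  field_simp

theorem integral_Ioi_one_besselKernel {c : ℝ} (hc : 0 < c) {ν : ℂ} (hν : ¬∃ j : ℤ, ν = j) :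
    (∫ t : ℝ in Set.Ioi 1, (t : ℂ) ^ (ν - 1) * besselKernel c t) =
      Real.pi / Complex.sin (ν * Real.pi) * besselI (-ν) ((2 * c : ℝ) : ℂ) -
        ∑' k : ℕ, ∑' j : ℕ, expTerm c k * (expTerm c j / (ν - k + j)) := by
  have hdouble : Summable fun k : ℕ => ∑' j : ℕ, expTerm c k * (expTerm c j / (ν - k + j)) :=
    (summable_expTerm_mul_expTerm_div hν).prod
  have h := (hasSum_upperGamma hc ν).add hdouble.hasSum
  rw [eq_sub_iff_add_eq, ← h.tsum_eq, besselI, ← tsum_mul_left]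
  refine tsum_congr fun k => ?_
  have hk : ¬∃ j : ℤ, ν - k = j := by
    simpa [sub_eq_add_neg] using not_int_add_int hν (-k)
  rw [← expTerm_mul_Gamma hc hν, upperGamma_eq hc hk, tsum_mul_left]
  ring

theorem mellinConvergent_indicator_besselKernel {c : ℝ} (hc : 0 < c) (ν : ℂ) :
    MellinConvergent ((Set.Ioi 1).indicator (besselKernel c)) ν := by
  have h := integrableOn_Ioi_one_besselKernel hc ν
  rw [← integrable_indicator_iff measurableSet_Ioi] at h
  refine h.integrableOn.congr_fun (fun t _ => ?_) measurableSet_Ioi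
  by_cases ht : t ∈ Set.Ioi (1 : ℝ) <;> simp [ht]

theorem mellin_indicator_besselKernel (c : ℝ) (ν : ℂ) :
    mellin ((Set.Ioi 1).indicator (besselKernel c)) ν =
      ∫ t : ℝ in Set.Ioi 1, (t : ℂ) ^ (ν - 1) * besselKernel c t := by
  have : ∀ t : ℝ, (t : ℂ) ^ (ν - 1) • (Set.Ioi 1).indicator (besselKernel c) t =
      (Set.Ioi 1).indicator (fun t : ℝ => (t : ℂ) ^ (ν - 1) * besselKernel c t) t := fun t => by
    by_cases ht : t ∈ Set.Ioi (1 : ℝ) <;> simp [ht]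
  simp only [mellin, this]
  rw [setIntegral_indicator measurableSet_Ioi,
    Set.inter_eq_right.2 (Set.Ioi_subset_Ioi zero_le_one)]

/-- `besselKernel` is the sum of its restriction to `t > 1` and the pullback of that by `t ↦ 1/t`,
outside of the null set `{1}`. -/
theorem besselKernel_ae_eq (c : ℝ) (ν : ℂ) :
    (fun t : ℝ => (t : ℂ) ^ (ν - 1) • besselKernel c t) =ᵐ[volume.restrict (Set.Ioi 0)]
      fun t : ℝ => (t : ℂ) ^ (ν - 1) • (Set.Ioi 1).indicator (besselKernel c) t +
        (t : ℂ) ^ (ν - 1) • (Set.Ioi 1).indicator (besselKernel c) t⁻¹ := by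
  have h1 : ∀ᵐ t : ℝ ∂volume.restrict (Set.Ioi 0), t ≠ 1 :=
    ae_restrict_of_ae (Measure.ae_ne volume 1)
  filter_upwards [h1, ae_restrict_mem measurableSet_Ioi] with t ht1 ht0
  have ht0' : (0 : ℝ) < t := ht0
  rcases lt_or_gt_of_ne ht1 with h | h
  · have h' : 1 < t⁻¹ := (one_lt_inv₀ ht0').2 h
    simp [h.not_gt, h', besselKernel_inv]
  · have h' : ¬1 < t⁻¹ := fun hh => ((one_lt_inv₀ ht0').1 hh).not_gt h
    simp only [Set.indicator, Set.mem_Ioi, h, h', if_true, if_false, smul_zero, add_zero]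

theorem mellinConvergent_indicator_besselKernel_inv {c : ℝ} (hc : 0 < c) (ν : ℂ) :
    MellinConvergent (fun t => (Set.Ioi 1).indicator (besselKernel c) t⁻¹) ν := by
  have := (MellinConvergent.comp_rpow (f := (Set.Ioi 1).indicator (besselKernel c)) (s := ν)
    (a := -1) (by norm_num)).2 (mellinConvergent_indicator_besselKernel hc _)
  simpa only [Real.rpow_neg_one] using this

theorem mellinConvergent_besselKernel {c : ℝ} (hc : 0 < c) (ν : ℂ) :
    MellinConvergent (besselKernel c) ν :=
  ((mellinConvergent_indicator_besselKernel hc ν).add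
    (mellinConvergent_indicator_besselKernel_inv hc ν)).congr (besselKernel_ae_eq c ν).symm

theorem mellin_besselKernel {c : ℝ} (hc : 0 < c) (ν : ℂ) :
    mellin (besselKernel c) ν =
      (∫ t : ℝ in Set.Ioi 1, (t : ℂ) ^ (ν - 1) * besselKernel c t) +
        ∫ t : ℝ in Set.Ioi 1, (t : ℂ) ^ (-ν - 1) * besselKernel c t := by
  rw [← mellin_indicator_besselKernel, ← mellin_indicator_besselKernel, ← mellin_comp_inv]
  simp only [mellin]
  rw [integral_congr_ae (besselKernel_ae_eq c ν)]
  exact integral_add (mellinConvergent_indicator_besselKernel hc ν)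
    (mellinConvergent_indicator_besselKernel_inv hc ν)

/-- The Mellin transform splits at `t = 1` into halves at `ν` and `-ν`, which give the series of
`I_{-ν}` and of `-I_ν`, while their double series cancel. -/
theorem besselKAux_eq_mellin {c : ℝ} (hc : 0 < c) {ν : ℂ} (hν : ¬∃ j : ℤ, ν = j) :
    besselKAux ν ((2 * c : ℝ) : ℂ) = 1 / 2 * mellin (besselKernel c) ν := by
  have hν' : ¬∃ j : ℤ, -ν = j := fun ⟨j, hj⟩ => hν ⟨-j, by push_cast; rw [← hj, neg_neg]⟩
  rw [mellin_besselKernel hc, integral_Ioi_one_besselKernel hc hν,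
    integral_Ioi_one_besselKernel hc hν', tsum_tsum_expTerm_div_neg hν, besselKAux, neg_neg,
    neg_mul, Complex.sin_neg]
  ring

theorem tendsto_mellin_besselKernel {c : ℝ} (hc : 0 < c) (ν : ℂ) :
    Tendsto (mellin (besselKernel c)) (𝓝 ν) (𝓝 (mellin (besselKernel c) ν)) := by
  have hconv : ∀ x : ℝ, IntegrableOn (fun t : ℝ => t ^ (x - 1) * ‖besselKernel c t‖)
      (Set.Ioi 0) := fun x =>
    IntegrableOn.congr_fun (Integrable.norm (mellinConvergent_besselKernel hc (x : ℂ)))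
      (fun t ht => by
        have ht0 : (0 : ℝ) < t := ht
        simp [Complex.norm_cpow_eq_rpow_re_of_pos ht0]) measurableSet_Ioi
  -- For `|Re (μ - ν)| < 1`, the power `t^{Re μ - 1}` lies below the sum of its two extreme cases.
  refine tendsto_integral_filter_of_dominated_convergence
    (fun t : ℝ => t ^ (ν.re + 1 - 1) * ‖besselKernel c t‖ +
      t ^ (ν.re - 1 - 1) * ‖besselKernel c t‖) ?_ ?_ ((hconv _).add (hconv _)) ?_
  · exact Eventually.of_forall fun μ => (mellinConvergent_besselKernel hc μ).aestronglyMeasurable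
  · filter_upwards [Metric.ball_mem_nhds ν one_pos] with μ hμ
    refine (ae_restrict_mem measurableSet_Ioi).mono fun t ht => ?_
    have ht0 : (0 : ℝ) < t := ht
    have hre : |μ.re - ν.re| < 1 := by
      rw [Metric.mem_ball, dist_eq_norm] at hμ
      simpa using (Complex.abs_re_le_norm (μ - ν)).trans_lt hμ
    rw [abs_lt] at hre
    rw [norm_smul, Complex.norm_cpow_eq_rpow_re_of_pos ht0, Complex.sub_re, Complex.one_re,
      ← add_mul]
    gcongr
    rcases le_total 1 t with h1 | h1
    · calc t ^ (μ.re - 1) ≤ t ^ (ν.re + 1 - 1) :=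
            Real.rpow_le_rpow_of_exponent_le h1 (by linarith)
        _ ≤ _ := le_add_of_nonneg_right (by positivity)
    · calc t ^ (μ.re - 1) ≤ t ^ (ν.re - 1 - 1) :=
            Real.rpow_le_rpow_of_exponent_ge ht0 h1 (by linarith)
        _ ≤ _ := le_add_of_nonneg_left (by positivity)
  · refine (ae_restrict_mem measurableSet_Ioi).mono fun t ht => ?_
    have h0 : (t : ℂ) ≠ 0 := by exact_mod_cast (ne_of_gt ht : t ≠ 0)
    refine Tendsto.smul_const ?_ _
    exact ((continuousAt_const_cpow h0).comp (by fun_prop : ContinuousAt (fun μ : ℂ => μ - 1) ν))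

/-- The integral representation of `K_ν(2c)` for every `ν`. At an integer both sides are limits from
non-integer parameters, since the Mellin transform is continuous in `ν`. -/
theorem besselK_eq_mellin {c : ℝ} (hc : 0 < c) (ν : ℂ) :
    besselK ν ((2 * c : ℝ) : ℂ) = 1 / 2 * mellin (besselKernel c) ν := by
  rw [besselK]
  split_ifs with hν
  · have hev : ∀ᶠ ε : ℂ in 𝓝[≠] ν, ¬∃ j : ℤ, ε = j := by
      obtain ⟨i, rfl⟩ := hν
      filter_upwards [self_mem_nhdsWithin,
        mem_nhdsWithin_of_mem_nhds (Metric.ball_mem_nhds (i : ℂ) one_pos)] with ε hε hball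
      rintro ⟨j, rfl⟩
      refine hε ?_
      rw [Metric.mem_ball, dist_eq_norm, ← Int.cast_sub, Complex.norm_intCast] at hball
      have : |j - i| < 1 := by exact_mod_cast hball
      rw [Int.abs_lt_one_iff, sub_eq_zero] at this
      rw [this]
      rfl
    refine Tendsto.limUnder_eq ?_
    refine Tendsto.congr' (hev.mono fun ε hε => (besselKAux_eq_mellin hc hε).symm) ?_
    exact ((tendsto_mellin_besselKernel hc ν).mono_left nhdsWithin_le_nhds).const_mul _
  · exact besselKAux_eq_mellin hc hν

/-! ### Fourier transforms of inverse powers on Euclidean spaces -/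

theorem integral_cpow_mul_exp_neg_add_sq {V : Type*} [SeminormedAddCommGroup V] {A : ℝ}
    (hA : 0 < A) {μ : ℂ} (hμ : 0 < μ.re) (ξ : V) :
    ∫ t : ℝ in Set.Ioi 0, (t : ℂ) ^ (μ - 1) * Complex.exp (-(((A + ‖ξ‖ ^ 2 : ℝ) : ℂ) * t)) =
      ((1 / (A + ‖ξ‖ ^ 2) : ℝ) : ℂ) ^ μ * Complex.Gamma μ := by
  rw [Complex.integral_cpow_mul_exp_neg_mul_Ioi hμ (by positivity : 0 < A + ‖ξ‖ ^ 2)]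
  push_cast
  rfl

section InnerProductSpace

variable {V : Type*} [NormedAddCommGroup V] [InnerProductSpace ℝ V] [FiniteDimensional ℝ V]
  [MeasurableSpace V] [BorelSpace V]

/-- The integrand of the Gamma integral for `(A + ‖ξ‖²)^{-μ}` is integrable in both variables when
`2 Re μ > dim V`. -/
theorem integrable_cpow_mul_exp_neg_add_sq {A : ℝ} (hA : 0 < A) {μ : ℂ}
    (hμ : (Module.finrank ℝ V : ℝ) / 2 < μ.re) :
    Integrable (fun p : V × ℝ =>
        (p.2 : ℂ) ^ (μ - 1) * Complex.exp (-(((A + ‖p.1‖ ^ 2 : ℝ) : ℂ) * p.2)))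
      ((volume : Measure V).prod (volume.restrict (Set.Ioi 0))) := by
  set d : ℝ := (Module.finrank ℝ V : ℝ) / 2 with hd
  have hmeas : AEStronglyMeasurable (fun p : V × ℝ =>
        (p.2 : ℂ) ^ (μ - 1) * Complex.exp (-(((A + ‖p.1‖ ^ 2 : ℝ) : ℂ) * p.2)))
      ((volume : Measure V).prod (volume.restrict (Set.Ioi 0))) := by
    have hprod : (volume : Measure V).prod (volume.restrict (Set.Ioi (0 : ℝ))) =
        ((volume : Measure V).prod (volume : Measure ℝ)).restrict (Set.univ ×ˢ Set.Ioi 0) := by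
      rw [← Measure.prod_restrict, Measure.restrict_univ]
    rw [hprod]
    refine ContinuousOn.aestronglyMeasurable (fun p hp => ?_)
      (MeasurableSet.univ.prod measurableSet_Ioi)
    have hp0 : (0 : ℝ) < p.2 := hp.2
    refine (ContinuousAt.mul ?_ (by fun_prop)).continuousWithinAt
    exact (Complex.continuousAt_ofReal_cpow_const p.2 (μ - 1) (Or.inr hp0.ne')).comp
      (f := fun p : V × ℝ => p.2) continuousAt_snd
  have hnorm : ∀ (ξ : V) {t : ℝ}, 0 < t →
      ‖(t : ℂ) ^ (μ - 1) * Complex.exp (-(((A + ‖ξ‖ ^ 2 : ℝ) : ℂ) * t))‖ =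
        t ^ (μ.re - 1) * Real.exp (-(A * t)) * Real.exp (-t * ‖ξ‖ ^ 2) := by
    intro ξ t ht
    rw [norm_mul, Complex.norm_cpow_eq_rpow_re_of_pos ht, Complex.norm_exp, mul_assoc,
      ← Real.exp_add]
    congr 2
    rw [← Complex.ofReal_mul, ← Complex.ofReal_neg, Complex.ofReal_re]
    ring
  rw [integrable_prod_iff' hmeas]
  constructor
  · refine (ae_restrict_mem measurableSet_Ioi).mono fun t ht => ?_
    have ht0 : (0 : ℝ) < t := ht
    have hg := GaussianFourier.integrable_cexp_neg_mul_sq_norm_add (V := V) (b := (t : ℂ))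
      (by simpa using ht0) 0 0
    refine (hg.const_mul ((t : ℂ) ^ (μ - 1) * Complex.exp (-(A * t)))).congr
      (Eventually.of_forall fun ξ => ?_)
    simp only
    rw [mul_assoc, ← Complex.exp_add]
    congr 2
    push_cast
    ring
  · have hdom := integrableOn_rpow_mul_exp_neg_mul_rpow (p := 1) (s := μ.re - 1 - d) (b := A)
      (by linarith) one_pos hA
    refine IntegrableOn.congr_fun (hdom.const_mul (Real.pi ^ d)) (fun t ht => ?_)
      measurableSet_Ioi
    have ht0 : (0 : ℝ) < t := ht
    simp only [hnorm _ ht0, Real.rpow_one]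
    rw [integral_const_mul, GaussianFourier.integral_rexp_neg_mul_sq_norm ht0, ← hd,
      Real.div_rpow Real.pi_pos.le ht0.le, Real.rpow_sub ht0 _ d, neg_mul]
    ring

/-- Integrability of the marginal of the two-variable Gamma integrand. -/
theorem integrable_one_div_add_sq_cpow {A : ℝ} (hA : 0 < A) {μ : ℂ}
    (hμ : (Module.finrank ℝ V : ℝ) / 2 < μ.re) :
    Integrable fun ξ : V => ((1 / (A + ‖ξ‖ ^ 2) : ℝ) : ℂ) ^ μ := by
  have hμ0 : 0 < μ.re := lt_of_le_of_lt (by positivity) hμ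
  have h := (integrable_cpow_mul_exp_neg_add_sq (V := V) hA hμ).integral_prod_left
  simp only [integral_cpow_mul_exp_neg_add_sq hA hμ0] at h
  exact (integrable_mul_const_iff
    (IsUnit.mk0 _ (Complex.Gamma_ne_zero_of_re_pos hμ0)) _).1 h

/-- The Fourier transform of `(A + ‖ξ‖²)^{-μ}` as a Mellin transform. -/
theorem integral_one_div_add_sq_cpow_mul_exp {A : ℝ} (hA : 0 < A) {μ : ℂ}
    (hμ : (Module.finrank ℝ V : ℝ) / 2 < μ.re) (w : V) :
    (∫ ξ : V, ((1 / (A + ‖ξ‖ ^ 2) : ℝ) : ℂ) ^ μ *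
        Complex.exp (-2 * Complex.I * Real.pi * (inner ℝ w ξ : ℝ))) * Complex.Gamma μ =
      (Real.pi : ℂ) ^ ((Module.finrank ℝ V : ℂ) / 2) *
        mellin (fun t : ℝ => Complex.exp (-(A * t + (Real.pi * ‖w‖) ^ 2 * (t : ℂ)⁻¹)))
          (μ - (Module.finrank ℝ V : ℂ) / 2) := by
  have hμ0 : 0 < μ.re := lt_of_le_of_lt (by positivity) hμ
  set e : V → ℂ := fun ξ => Complex.exp (-2 * Complex.I * Real.pi * (inner ℝ w ξ : ℝ)) with he
  have hint : Integrable (Function.uncurry fun (ξ : V) (t : ℝ) => e ξ *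
        ((t : ℂ) ^ (μ - 1) * Complex.exp (-(((A + ‖ξ‖ ^ 2 : ℝ) : ℂ) * t))))
      ((volume : Measure V).prod (volume.restrict (Set.Ioi 0))) := by
    refine (integrable_cpow_mul_exp_neg_add_sq (V := V) hA hμ).bdd_mul (c := 1)
      (f := fun p : V × ℝ => e p.1) ?_ (Eventually.of_forall fun p => ?_)
    · have : Continuous fun p : V × ℝ => e p.1 := by fun_prop
      exact this.aestronglyMeasurable
    · rw [he, Complex.norm_exp]
      simp
  calc _ = ∫ ξ : V, ∫ t : ℝ in Set.Ioi 0, e ξ *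
        ((t : ℂ) ^ (μ - 1) * Complex.exp (-(((A + ‖ξ‖ ^ 2 : ℝ) : ℂ) * t))) := by
        rw [← integral_mul_const]
        refine integral_congr_ae (Eventually.of_forall fun ξ => ?_)
        simp only
        rw [integral_const_mul, integral_cpow_mul_exp_neg_add_sq hA hμ0]
        ring
    _ = ∫ t : ℝ in Set.Ioi 0, ∫ ξ : V, e ξ *
        ((t : ℂ) ^ (μ - 1) * Complex.exp (-(((A + ‖ξ‖ ^ 2 : ℝ) : ℂ) * t))) :=
        integral_integral_swap hint
    _ = _ := by
        rw [mellin, ← integral_const_mul]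
        refine setIntegral_congr_fun measurableSet_Ioi fun t ht => ?_
        have ht0 : (0 : ℝ) < t := ht
        have htc : (t : ℂ) ≠ 0 := by exact_mod_cast ht0.ne'
        have h1 : ∀ ξ : V, e ξ *
            ((t : ℂ) ^ (μ - 1) * Complex.exp (-(((A + ‖ξ‖ ^ 2 : ℝ) : ℂ) * t))) =
            ((t : ℂ) ^ (μ - 1) * Complex.exp (-(A * t))) *
              Complex.exp (-(t : ℂ) * ‖ξ‖ ^ 2 + (-2 * Complex.I * Real.pi) * (inner ℝ w ξ : ℝ)) := by
          intro ξ
          rw [he, mul_left_comm, mul_assoc ((t : ℂ) ^ (μ - 1)), ← Complex.exp_add, ← Complex.exp_add]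
          congr 2
          push_cast
          ring
        simp only [h1]
        rw [integral_const_mul, GaussianFourier.integral_cexp_neg_mul_sq_norm_add
          (by simpa using ht0), smul_eq_mul, sub_right_comm, Complex.cpow_sub (μ - 1) _ htc]
        have h2 : ((Real.pi : ℂ) / t) ^ ((Module.finrank ℝ V : ℂ) / 2) =
            (Real.pi : ℂ) ^ ((Module.finrank ℝ V : ℂ) / 2) /
              (t : ℂ) ^ ((Module.finrank ℝ V : ℂ) / 2) :=
          Complex.div_cpow_ofReal_nonneg Real.pi_pos.le ht0.le _
        have h3 : Complex.exp (-(A * t + (Real.pi * ‖w‖) ^ 2 * (t : ℂ)⁻¹)) =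
            Complex.exp (-(A * t)) *
              Complex.exp ((-2 * Complex.I * Real.pi) ^ 2 * ‖w‖ ^ 2 / (4 * t)) := by
          rw [← Complex.exp_add]
          congr 1
          field_simp
          linear_combination (-4 * (Real.pi : ℂ) ^ 2 * (‖w‖ : ℂ) ^ 2) * Complex.I_sq
        rw [h2, h3]
        ring

/-- The substitution `t ↦ (a / b) t` brings `a² t + b² / t` to the form `ab (t + 1/t)`. -/
theorem mellin_exp_neg_eq_besselK {a b : ℝ} (ha : 0 < a) (hb : 0 < b) (ν : ℂ) :
    mellin (fun t : ℝ => Complex.exp (-((a ^ 2 : ℝ) * t + (b : ℂ) ^ 2 * (t : ℂ)⁻¹))) ν =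
      2 * ((b / a : ℝ) : ℂ) ^ ν * besselK ν ((2 * (a * b) : ℝ) : ℂ) := by
  have hac : (a : ℂ) ≠ 0 := by exact_mod_cast ha.ne'
  have hbc : (b : ℂ) ≠ 0 := by exact_mod_cast hb.ne'
  have h1 : (fun t : ℝ => Complex.exp (-((a ^ 2 : ℝ) * t + (b : ℂ) ^ 2 * (t : ℂ)⁻¹))) =
      fun t : ℝ => besselKernel (a * b) (a / b * t) := by
    funext t
    simp only [besselKernel]
    congr 2
    push_cast
    rw [mul_inv, inv_div]
    field_simp
  have h2 : ((a / b : ℝ) : ℂ) ^ (-ν) = ((b / a : ℝ) : ℂ) ^ ν := by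
    have harg : ((b / a : ℝ) : ℂ).arg ≠ Real.pi := by
      rw [Complex.arg_ofReal_of_nonneg (by positivity)]
      exact Real.pi_pos.ne
    rw [← inv_div, Complex.ofReal_inv, Complex.inv_cpow _ _ harg, Complex.cpow_neg, inv_inv]
  rw [h1, mellin_comp_mul_left _ _ (by positivity), besselK_eq_mellin (by positivity), h2,
    smul_eq_mul]
  ring

/-- The Fourier transform of `(a² + ‖ξ‖²)^{-μ}` on a Euclidean space, at a non-zero frequency. -/
theorem integral_one_div_sq_add_sq_cpow_mul_exp {a : ℝ} (ha : 0 < a) {μ : ℂ}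
    (hμ : (Module.finrank ℝ V : ℝ) / 2 < μ.re) {w : V} (hw : w ≠ 0) :
    (∫ ξ : V, ((1 / (a ^ 2 + ‖ξ‖ ^ 2) : ℝ) : ℂ) ^ μ *
        Complex.exp (-2 * Complex.I * Real.pi * (inner ℝ w ξ : ℝ))) =
      2 * ((Real.pi : ℂ) ^ μ / Complex.Gamma μ) *
        ((‖w‖ / a : ℝ) : ℂ) ^ (μ - (Module.finrank ℝ V : ℂ) / 2) *
        besselK (μ - (Module.finrank ℝ V : ℂ) / 2) ((2 * Real.pi * a * ‖w‖ : ℝ) : ℂ) := by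
  have hμ0 : 0 < μ.re := lt_of_le_of_lt (by positivity) hμ
  have hΓ := Complex.Gamma_ne_zero_of_re_pos hμ0
  have hw0 : 0 < ‖w‖ := norm_pos_iff.2 hw
  have hpi : (Real.pi : ℂ) ≠ 0 := by exact_mod_cast Real.pi_ne_zero
  refine mul_right_cancel₀ hΓ ?_
  have hm := mellin_exp_neg_eq_besselK ha (mul_pos Real.pi_pos hw0)
    (μ - (Module.finrank ℝ V : ℂ) / 2)
  rw [Complex.ofReal_mul Real.pi ‖w‖] at hm
  rw [integral_one_div_add_sq_cpow_mul_exp (by positivity) hμ, hm, mul_div_assoc,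
    Complex.ofReal_mul Real.pi (‖w‖ / a),
    Complex.mul_cpow_ofReal_nonneg Real.pi_pos.le (by positivity),
    show 2 * (a * (Real.pi * ‖w‖)) = 2 * Real.pi * a * ‖w‖ by ring]
  have hsplit : (Real.pi : ℂ) ^ μ = (Real.pi : ℂ) ^ ((Module.finrank ℝ V : ℂ) / 2) *
      (Real.pi : ℂ) ^ (μ - (Module.finrank ℝ V : ℂ) / 2) := by
    rw [← Complex.cpow_add _ _ hpi, add_sub_cancel]
  rw [hsplit]
  field_simp

end InnerProductSpace

/-! ### The non-compact form -/

theorem aFun_pos {m : ℕ} (s : ℂ) (u : CVec m) : 0 < aFun s u := by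
  unfold aFun
  positivity

theorem norm_hyperplanePoint_sq {m : ℕ} (s : ℂ) (u ξ : CVec m) :
    ‖hyperplanePoint s u ξ‖ ^ 2 = aFun s u ^ 2 + ‖ξ‖ ^ 2 := by
  rw [aFun, Real.sq_sqrt (by positivity), WithLp.prod_norm_sq_eq_of_L2, EuclideanSpace.norm_sq_eq,
    EuclideanSpace.norm_sq_eq, EuclideanSpace.norm_sq_eq, EuclideanSpace.norm_sq_eq]
  simp [hyperplanePoint, Fin.sum_univ_succ, mul_pow]
  ring

/-- The homogeneity degree and the polynomial combine into one power, as `‖(1, u, 2s, ξ)‖² =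
a(s, u)² + ‖ξ‖²` and the first coordinate is `1`. -/
theorem nonCompactForm_eq (m : ℕ) (lam : ℝ) (α β : ℕ) (s : ℂ) (u ξ : CVec m) :
    nonCompactForm m lam α β s u ξ =
      (2 * s) ^ α * ((1 / (aFun s u ^ 2 + ‖ξ‖ ^ 2) : ℝ) : ℂ) ^
        ((Complex.I * lam + ((α + β : ℕ) : ℂ)) / 2 + ((m + 1 : ℕ) : ℂ)) := by
  have ha := aFun_pos s u
  have hsq := norm_hyperplanePoint_sq s u ξ
  have hN : 0 < ‖hyperplanePoint s u ξ‖ := by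
    refine lt_of_le_of_ne (norm_nonneg _) fun h => ?_
    rw [← h] at hsq
    have : 0 < aFun s u ^ 2 + ‖ξ‖ ^ 2 := by positivity
    rw [← hsq] at this
    norm_num at this
  rw [← hsq, nonCompactForm, inducedForm, hwPoly]
  generalize hNr : 1 / ‖hyperplanePoint s u ξ‖ = r
  have hr : 0 < r := hNr ▸ one_div_pos.2 hN
  have hrc : (r : ℂ) ≠ 0 := by exact_mod_cast hr.ne'
  have hrsq : 1 / ‖hyperplanePoint s u ξ‖ ^ 2 = r ^ 2 := by rw [← hNr, one_div_pow]
  have hpow : ((r ^ 2 : ℝ) : ℂ) ^ ((Complex.I * lam + ((α + β : ℕ) : ℂ)) / 2 + ((m + 1 : ℕ) : ℂ)) =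
      (r : ℂ) ^ (Complex.I * lam + 2 * ((m + 1 : ℕ) : ℂ)) * (r : ℂ) ^ α * (r : ℂ) ^ β := by
    rw [pow_two, Complex.ofReal_mul, Complex.mul_cpow_ofReal_nonneg hr.le hr.le,
      ← Complex.cpow_add _ _ hrc, ← Complex.cpow_natCast, ← Complex.cpow_natCast,
      ← Complex.cpow_add _ _ hrc, ← Complex.cpow_add _ _ hrc]
    congr 1
    push_cast
    ring
  rw [hrsq, hpow]
  simp [hyperplanePoint]
  ring

/-- The pairing `Re ⟨v, ξ⟩` is complex bilinear inside, so it is the real inner product of `ξ` with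
the conjugate of `v`. -/
theorem re_sum_mul_eq_inner {m : ℕ} (v ξ : CVec m) :
    (∑ i, v i * ξ i).re = inner ℝ (WithLp.toLp 2 fun i => starRingEnd ℂ (v i) : CVec m) ξ := by
  simp [PiLp.inner_apply, Complex.inner, mul_comm]

theorem norm_toLp_conj {m : ℕ} (v : CVec m) :
    ‖(WithLp.toLp 2 fun i => starRingEnd ℂ (v i) : CVec m)‖ = ‖v‖ := by
  simp [EuclideanSpace.norm_eq]

end SymplecticBessel

open SymplecticBessel

theorem proposition4 (m n : ℕ) (hn : 2 ≤ n) (hmn : n = m + 1) (lam : ℝ)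
    (k α β : ℕ) (hk : α + β = k) (Λ : ℂ) (hΛ : Λ = (Complex.I * (lam : ℂ) + (k : ℂ)) / 2)
    (s : ℂ) (u v : SymplecticBessel.CVec m) (hv : v ≠ 0) :
    MeasureTheory.Integrable
        (fun ξ : SymplecticBessel.CVec m =>
          SymplecticBessel.nonCompactForm m lam α β s u ξ) MeasureTheory.volume ∧
      SymplecticBessel.fourierXi (SymplecticBessel.nonCompactForm m lam α β) s u v =
        2 ^ (α + 1) * s ^ α *
          ((Real.pi : ℂ) ^ (Λ + (n : ℂ)) / Complex.Gamma (Λ + (n : ℂ))) *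
          ((‖v‖ / SymplecticBessel.aFun s u : ℝ) : ℂ) ^ (Λ + 1) *
          SymplecticBessel.besselK (Λ + 1)
            ((2 * Real.pi * SymplecticBessel.aFun s u * ‖v‖ : ℝ) : ℂ) := by
  subst hmn hk
  have ha := aFun_pos s u
  have hfin : Module.finrank ℝ (CVec m) = 2 * m := by
    rw [← Module.finrank_mul_finrank ℝ ℂ (CVec m), Complex.finrank_real_complex,
      finrank_euclideanSpace_fin]
  have hν : Λ + ((m + 1 : ℕ) : ℂ) - (Module.finrank ℝ (CVec m) : ℂ) / 2 = Λ + 1 := by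
    rw [hfin]
    push_cast
    ring
  have hre : (Module.finrank ℝ (CVec m) : ℝ) / 2 < (Λ + ((m + 1 : ℕ) : ℂ)).re := by
    have h : (Λ + ((m + 1 : ℕ) : ℂ)).re = ((α : ℝ) + β) / 2 + (m + 1) := by
      rw [hΛ, Complex.add_re, Complex.div_ofNat_re]
      simp
    rw [hfin, h]
    push_cast
    have : (0 : ℝ) ≤ (α : ℝ) + β := by positivity
    linarith
  have hG : ∀ ξ : CVec m, nonCompactForm m lam α β s u ξ = (2 * s) ^ α *
      ((1 / (aFun s u ^ 2 + ‖ξ‖ ^ 2) : ℝ) : ℂ) ^ (Λ + ((m + 1 : ℕ) : ℂ)) := fun ξ => by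
    rw [nonCompactForm_eq, hΛ]
  refine ⟨?_, ?_⟩
  · simp only [hG]
    exact (integrable_one_div_add_sq_cpow (by positivity) hre).const_mul _
  · have hw : (WithLp.toLp 2 fun i => starRingEnd ℂ (v i) : CVec m) ≠ 0 := by
      rw [← norm_pos_iff, norm_toLp_conj]
      exact norm_pos_iff.2 hv
    have key := integral_one_div_sq_add_sq_cpow_mul_exp ha hre hw
    rw [hν, norm_toLp_conj] at key
    simp only [fourierXi, hG, re_sum_mul_eq_inner, mul_assoc ((2 * s) ^ α)]
    rw [integral_const_mul, key, mul_pow]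
    ring
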